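/- A signed graph $(G,\sigma)$ is a multigraph $G$ (parallel edges allowed, no loops) with a sign $\sigma(e)\in\{+1,-1\}$ for each edge $e$. An orientation of $(G,\sigma)$ orients each of the two half-edges of every edge so that exactly one of them points to its endvertex if the edge is positive, and none or both of them do if the edge is negative. A nowhere-zero $k$-flow on $(G,\sigma)$ consists of an orientation and an assignment of a nonzero integer of absolute value less than $k$ to each edge such that at every vertex the sum of the incoming values equals the sum of the outgoing values; $(G,\sigma)$ is flow-admissible if it has a nowhere-zero $k$-flow for some $k$. A graph is series-parallel if, for some choice of two distinct terminals, it can be obtained from copies of $K_2$ by iterated series and parallel connections of two-terminal graphs. Theorem. Every flow-admissible signed graph whose underlying graph is series-parallel has a nowhere-zero $6$-flow. -/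

import Mathlib

open scoped Graph

namespace SignedSP

universe u v

/-- `G` is the union of its subgraphs `H` and `K`, which have no edge in common and whose common
vertices are exactly those of `S`. Equivalently, `G` is obtained from the disjoint union of two
graphs by identifying vertices of the one with vertices of the other, `S` being the set of
vertices that result from an identification. -/
structure IsGluing {α : Type u} {β : Type v} (G H K : Graph α β) (S : Set α) : Prop where
  left_le : H ≤ G
  right_le : K ≤ G
  vertexSet_eq : V(G) = V(H) ∪ V(K)
  edgeSet_eq : E(G) = E(H) ∪ E(K)
  edge_disjoint : Disjoint E(H) E(K)
  vertex_inter : V(H) ∩ V(K) = S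

/-- `IsSeriesParallel G s t`: the two-terminal multigraph `(G, s, t)` is series-parallel, i.e. it is
obtained from copies of `K₂` by iterated series and parallel connections. (Connections of more
than two graphs are iterated connections of two.) -/
inductive IsSeriesParallel {α : Type u} {β : Type v} : Graph α β → α → α → Prop
  /-- A single edge `e` with distinct ends `s`, `t`. -/
  | edge (e : β) (s t : α) (hst : s ≠ t) : IsSeriesParallel (Graph.banana s t {e}) s t
  /-- Series connection: the target terminal of `H` is identified with the source terminal of `K`,
  and no other identification takes place. -/
  | series (G H K : Graph α β) (s m t : α)
      (hH : IsSeriesParallel H s m) (hK : IsSeriesParallel K m t)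
      (hG : IsGluing G H K {m}) : IsSeriesParallel G s t
  /-- Parallel connection: the source terminals are identified, the target terminals are
  identified, and no other identification takes place. -/
  | parallel (G H K : Graph α β) (s t : α)
      (hH : IsSeriesParallel H s t) (hK : IsSeriesParallel K s t)
      (hG : IsGluing G H K {s, t}) : IsSeriesParallel G s t

/-- An orientation of the signed graph `(G, σ)`, for `G` without loops. The half-edges of `G` are
the pairs `(e, x)` where `x` is an end of the edge `e`; `D e x` says that the half-edge `(e, x)`
points to its end `x` (otherwise it points away from `x`). Of the two half-edges of an edge, exactly
one points to its end if the edge is positive; none or both do if the edge is negative.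
The values of `σ` and `D` elsewhere are irrelevant. -/
def IsOrientation {α : Type u} {β : Type v} (G : Graph α β) (σ : β → ℤˣ)
    (D : β → α → Prop) : Prop :=
  ∀ e x y, G.IsLink e x y →
    (σ e = 1 → Xor (D e x) (D e y)) ∧ (σ e = -1 → (D e x ↔ D e y))

/-- The sum of the incoming values at the vertex `x`. -/
noncomputable def inflow {α : Type u} {β : Type v} (G : Graph α β) (D : β → α → Prop)
    (φ : β → ℤ) (x : α) : ℤ :=
  ∑ᶠ e ∈ {e | G.Inc e x ∧ D e x}, φ e

/-- The sum of the outgoing values at the vertex `x`. -/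
noncomputable def outflow {α : Type u} {β : Type v} (G : Graph α β) (D : β → α → Prop)
    (φ : β → ℤ) (x : α) : ℤ :=
  ∑ᶠ e ∈ {e | G.Inc e x ∧ ¬ D e x}, φ e

/-- `(D, φ)` is a nowhere-zero `k`-flow on the (finite, loopless) signed graph `(G, σ)`. -/
structure IsNowhereZeroFlow {α : Type u} {β : Type v} (G : Graph α β) (σ : β → ℤˣ) (k : ℕ)
    (D : β → α → Prop) (φ : β → ℤ) : Prop where
  orientation : IsOrientation G σ D
  ne_zero : ∀ e ∈ E(G), φ e ≠ 0
  abs_lt : ∀ e ∈ E(G), |φ e| < (k : ℤ)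
  conservation : ∀ x ∈ V(G), inflow G D φ x = outflow G D φ x

/-- The signed graph `(G, σ)` has a nowhere-zero `k`-flow. -/
def HasNowhereZeroFlow {α : Type u} {β : Type v} (G : Graph α β) (σ : β → ℤˣ) (k : ℕ) : Prop :=
  ∃ (D : β → α → Prop) (φ : β → ℤ), IsNowhereZeroFlow G σ k D φ

/-- The signed graph `(G, σ)` has a nowhere-zero `k`-flow for some `k`. -/
def IsFlowAdmissible {α : Type u} {β : Type v} (G : Graph α β) (σ : β → ℤˣ) : Prop :=
  ∃ k : ℕ, HasNowhereZeroFlow G σ k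

end SignedSP

/-!
A flow in a two-terminal signed graph `(G, s, t)` that need not be conservative at `s` and `t` has a
boundary value `(a, b)`, the net inflow at `s` and the net outflow at `t`. A parallel connection
adds the sets of boundary values, a series connection composes them as relations
(`transmits_parallel`, `transmits_series`); both hold for the set `Q` of boundary values of all
nowhere-zero flows and for the set `R` of those of nowhere-zero 6-flows. The theorem says that
`(0, 0) ∈ Q` implies `(0, 0) ∈ R`, so it is enough to find a property of the pair `(Q, R)` that
implies this, holds for single edges and is preserved by sums and compositions.

If `G` is balanced, then for some sign `ε` all of `Q` lies on the line `b = ε * a`, and `R` contains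
all points of this line with `0 < |a| ≤ 5` (`BalancedPair`). If `G` is unbalanced, then `R` contains
almost all points of the same parity in the square `|a|, |b| ≤ 5`, with two reservations
(`UnbalancedPair`). First, each of the lines `a = 0`, `b = 0`, `b = a`, `b = -a` may be missed by `Q`
altogether; but whenever `Q` meets one of them in any point, `R` contains small points on it. Second,
since series connection of unbalanced graphs has only `±2` and `±4` as even nonzero values at the new
vertex, the points `(a, b)` with `|a|, |b| ∈ {2, 4}` are available only for `|a| = |b|` or only for
`|a| ≠ |b|`; these two possibilities compose like the elements of a group of order two, and either
of them suffices in a parallel connection. That the properties are preserved is then a finite check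
in each of the cases.
-/

namespace SignedSP

/-! ### The two invariants -/

/-- The odd integers of absolute value less than 6. -/
def oddValues : Finset ℤ := {-5, -3, -1, 1, 3, 5}
/-- The nonzero even integers of absolute value less than 6. -/
def evenValues : Finset ℤ := {-4, -2, 2, 4}
/-- The values allowed on the edges in a nowhere-zero 6-flow. -/
def allValues : Finset ℤ := {-5, -4, -3, -2, -1, 1, 2, 3, 4, 5}

/-- The invariant of a balanced two-terminal graph, all of whose `s`-`t` paths have sign `ε`: the graph
of `x ↦ ε * x` contains `Q` and is, within the range `|x| ≤ 5`, contained in `R`, except that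
`(0, 0)` is required to lie in `R` only if it lies in `Q`. Here `Q` and `R` are thought of as the boundary values
of the nowhere-zero flows, and of those with values less than 6 in modulus. -/
structure BalancedPair (ε : ℤˣ) (Q R : ℤ → ℤ → Prop) : Prop where
  eq_mul : ∀ a b, Q a b → b = ε * a
  zero : Q 0 0 → R 0 0
  lower : ∀ x ∈ allValues, R x (ε * x)

/-- The invariant of an unbalanced two-terminal graph, for `Q` and `R` as in `BalancedPair`. The four
lines `a = 0`, `b = 0`, `b = a` and `b = -a` are those that `Q` can miss, which happens if a boundary
value on the line forces some edge value to be zero. Correspondingly `R` is required to meet such a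
line only if `Q` does. The alternative in `even` reflects that a series connection of two unbalanced
graphs leaves few choices for a nonzero even value at the new vertex, only `±2` and `±4`. -/
structure UnbalancedPair (Q R : ℤ → ℤ → Prop) : Prop where
  zero : Q 0 0 → R 0 0
  odd : ∀ a ∈ oddValues, ∀ b ∈ oddValues, a.natAbs ≠ b.natAbs → R a b
  diag : ∀ ε : ℤˣ, (∃ a, Q a (ε * a)) → ∀ a ∈ ({-3, -1, 1, 3} : Finset ℤ), R a (ε * a)
  left : (∃ b, Q 0 b) → ∀ b ∈ evenValues, R 0 b
  right : (∃ a, Q a 0) → ∀ a ∈ evenValues, R a 0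
  even : (∀ a ∈ evenValues, ∀ b ∈ evenValues, a.natAbs = b.natAbs → R a b) ∨
    (∀ a ∈ evenValues, ∀ b ∈ evenValues, a.natAbs ≠ b.natAbs → R a b)

/-- The Minkowski sum of two relations, which describes a parallel connection. (The counterpart for a
series connection is `Relation.Comp`.) -/
def Par (Q₁ Q₂ : ℤ → ℤ → Prop) (a b : ℤ) : Prop :=
  ∃ a₁ b₁ a₂ b₂, Q₁ a₁ b₁ ∧ Q₂ a₂ b₂ ∧ a = a₁ + a₂ ∧ b = b₁ + b₂

lemma Par.intro {R₁ R₂ : ℤ → ℤ → Prop} {a b a' b' : ℤ} (h₁ : R₁ (a - a') (b - b'))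
    (h₂ : R₂ a' b') : Par R₁ R₂ a b :=
  ⟨_, _, _, _, h₁, h₂, by ring, by ring⟩

lemma Par.symm {R₁ R₂ : ℤ → ℤ → Prop} {a b : ℤ} (h : Par R₁ R₂ a b) : Par R₂ R₁ a b := by
  obtain ⟨a₁, b₁, a₂, b₂, h₁, h₂, rfl, rfl⟩ := h
  exact ⟨_, _, _, _, h₂, h₁, add_comm _ _, add_comm _ _⟩

lemma Par.comm (R₁ R₂ : ℤ → ℤ → Prop) : Par R₁ R₂ = Par R₂ R₁ := by
  ext a b
  exact ⟨Par.symm, Par.symm⟩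

variable {Q R Q₁ R₁ Q₂ R₂ : ℤ → ℤ → Prop} {ε δ : ℤˣ}

/-! ### Parallel connection of the invariants -/

lemma BalancedPair.par_same (h₁ : BalancedPair ε Q₁ R₁) (h₂ : BalancedPair ε Q₂ R₂) :
    BalancedPair ε (Par Q₁ Q₂) (Par R₁ R₂) := by
  have key : ∀ x ∈ insert 0 allValues, ∃ y ∈ allValues, x - y ∈ allValues := by decide
  have low : ∀ x ∈ insert 0 allValues, Par R₁ R₂ x (ε * x) := fun x hx ↦ by
    obtain ⟨y, hy, hxy⟩ := key x hx
    refine Par.intro ?_ (h₂.lower y hy)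
    rw [← mul_sub]
    exact h₁.lower _ hxy
  refine ⟨?_, fun _ ↦ by simpa using low 0 (by decide),
    fun x hx ↦ low x (Finset.mem_insert_of_mem hx)⟩
  rintro a b ⟨a₁, b₁, a₂, b₂, hq₁, hq₂, rfl, rfl⟩
  rw [h₁.eq_mul _ _ hq₁, h₂.eq_mul _ _ hq₂, mul_add]

/-- The sum `(y, y) + (z, -z)` of boundary values of the two parts is `(y + z, y - z)`, and
`y = (a + b) / 2`, `z = (a - b) / 2` are nonzero off the lines `b = a` and `b = -a`. -/
lemma BalancedPair.par_opposite (h₁ : BalancedPair 1 Q₁ R₁) (h₂ : BalancedPair (-1) Q₂ R₂) :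
    UnbalancedPair (Par Q₁ Q₂) (Par R₁ R₂) := by
  have key : ∀ y ∈ allValues, ∀ z ∈ allValues, Par R₁ R₂ (y + z) (y - z) := fun y hy z hz ↦
    ⟨y, y, z, -z, by simpa using h₁.lower y hy, by simpa using h₂.lower z hz, rfl, rfl⟩
  -- A boundary value on the line `b = a` (or `b = -a`) forces the flow through the negative
  -- (or positive) part to be zero.
  have diag₁ : ∀ a, Par Q₁ Q₂ a a → R₂ 0 0 := by
    rintro a ⟨a₁, b₁, a₂, b₂, hq₁, hq₂, h, h'⟩
    have e₁ := h₁.eq_mul _ _ hq₁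
    have e₂ := h₂.eq_mul _ _ hq₂
    simp only [Units.val_neg, Units.val_one] at e₁ e₂
    obtain rfl : a₂ = 0 := by omega
    obtain rfl : b₂ = 0 := by omega
    exact h₂.zero hq₂
  have diag₂ : ∀ a, Par Q₁ Q₂ a (-a) → R₁ 0 0 := by
    rintro a ⟨a₁, b₁, a₂, b₂, hq₁, hq₂, h, h'⟩
    have e₁ := h₁.eq_mul _ _ hq₁
    have e₂ := h₂.eq_mul _ _ hq₂
    simp only [Units.val_neg, Units.val_one] at e₁ e₂
    obtain rfl : a₁ = 0 := by omega
    obtain rfl : b₁ = 0 := by omega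
    exact h₁.zero hq₁
  have off : ∀ a ∈ oddValues ∪ insert 0 evenValues, ∀ b ∈ oddValues ∪ insert 0 evenValues,
      a.natAbs ≠ b.natAbs → (a - b) % 2 = 0 → Par R₁ R₂ a b := by
    intro a ha b hb hab hmod
    have : ∀ a ∈ oddValues ∪ insert 0 evenValues, ∀ b ∈ oddValues ∪ insert 0 evenValues,
      a.natAbs ≠ b.natAbs → (a - b) % 2 = 0 →
      ∃ y ∈ allValues, ∃ z ∈ allValues, y + z = a ∧ y - z = b := by decide +kernel
    obtain ⟨y, hy, z, hz, rfl, rfl⟩ := this a ha b hb hab hmod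
    exact key y hy z hz
  have sub : ({-3, -1, 1, 3} : Finset ℤ) ⊆ allValues := by decide
  refine ⟨fun h ↦ ⟨0, 0, 0, 0, diag₂ 0 (by simpa using h), diag₁ 0 h, rfl, rfl⟩, ?_, ?_, ?_, ?_, ?_⟩
  · intro a ha b hb hab
    exact off a (Finset.mem_union_left _ ha) b (Finset.mem_union_left _ hb) hab
      ((by decide : ∀ a ∈ oddValues, ∀ b ∈ oddValues, (a - b) % 2 = 0) a ha b hb)
  · rintro ε ⟨a, ha⟩ x hx
    rcases Int.units_eq_one_or ε with rfl | rfl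
    · have := diag₁ a (by simpa using ha)
      exact ⟨x, x, 0, 0, by simpa using h₁.lower x (sub hx), this, by simp, by simp⟩
    · have := diag₂ a (by simpa using ha)
      exact ⟨0, 0, x, -x, this, by simpa using h₂.lower x (sub hx), by simp, by simp⟩
  · exact fun _ b hb ↦ off 0 (by decide) b (by simp [hb]) (by revert b; decide) (by revert b; decide)
  · exact fun _ a ha ↦ off a (by simp [ha]) 0 (by decide) (by revert a; decide) (by revert a; decide)
  · exact .inr fun a ha b hb hab ↦ off a (by simp [ha]) b (by simp [hb]) hab
      ((by decide : ∀ a ∈ evenValues, ∀ b ∈ evenValues, (a - b) % 2 = 0) a ha b hb)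

/-- Every boundary value off the line `b = ε * a`, apart from `±(5, -5 * ε)`, becomes an odd one with
coordinates of distinct absolute values after subtracting some `(x, ε * x)`; on the line itself,
the sum meets it only if `Q₁` does. -/
lemma UnbalancedPair.par_balanced (h₁ : UnbalancedPair Q₁ R₁) (h₂ : BalancedPair ε Q₂ R₂) :
    UnbalancedPair (Par Q₁ Q₂) (Par R₁ R₂) := by
  have shift : ∀ a b x, x ∈ allValues → a - x ∈ oddValues → b - ε * x ∈ oddValues →
      (a - x).natAbs ≠ (b - ε * x).natAbs → Par R₁ R₂ a b := fun a b x hx ha hb hab ↦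
    Par.intro (h₁.odd _ ha _ hb hab) (h₂.lower x hx)
  have diag : (∃ a, Par Q₁ Q₂ a (ε * a)) → ∃ a, Q₁ a (ε * a) := by
    rintro ⟨a, a₁, b₁, a₂, b₂, hq₁, hq₂, rfl, h⟩
    rw [h₂.eq_mul _ _ hq₂, mul_add, add_left_inj] at h
    exact ⟨a₁, h ▸ hq₁⟩
  -- The values `(±5, ±5)` are excluded: `(5, -5) - (x, x)` always leaves the range.
  have key : ∀ a ∈ oddValues ∪ insert 0 evenValues, ∀ b ∈ oddValues ∪ insert 0 evenValues,
      (a - b) % 2 = 0 → (a.natAbs = 5 → b.natAbs ≠ 5) → b ≠ ε * a → Par R₁ R₂ a b := by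
    have : ∀ a ∈ oddValues ∪ insert 0 evenValues, ∀ b ∈ oddValues ∪ insert 0 evenValues,
        (a - b) % 2 = 0 → (a.natAbs = 5 → b.natAbs ≠ 5) → b ≠ ε * a →
        ∃ x ∈ allValues, a - x ∈ oddValues ∧ b - ε * x ∈ oddValues ∧
          (a - x).natAbs ≠ (b - ε * x).natAbs := by
      rcases Int.units_eq_one_or ε with rfl | rfl <;> decide +kernel
    intro a ha b hb hmod h5 hab
    obtain ⟨x, hx, hx₁, hx₂, hx₃⟩ := this a ha b hb hmod h5 hab
    exact shift a b x hx hx₁ hx₂ hx₃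
  have natAbs_ne : ∀ {δ : ℤˣ} {a b : ℤ}, a.natAbs ≠ b.natAbs → b ≠ δ * a := by
    rintro δ a _ hab rfl
    rcases Int.units_eq_one_or δ with rfl | rfl <;> simp at hab
  refine ⟨fun h ↦ ?_, ?_, ?_, ?_, ?_, ?_⟩
  -- A zero-boundary flow of the sum restricts to one of the first part on the line `b = ε * a`,
  -- hence `(-1, -ε)` is available there, and `(1, ε)` in the second part cancels it.
  · have := h₁.diag ε (diag ⟨0, by simpa using h⟩) (-1) (by decide)
    exact Par.intro (a' := 1) (b' := ε) (by simpa using this) (by simpa using h₂.lower 1 (by decide))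
  · exact fun a ha b hb hab ↦ key a (Finset.mem_union_left _ ha) b (Finset.mem_union_left _ hb)
      ((by decide : ∀ a ∈ oddValues, ∀ b ∈ oddValues, (a - b) % 2 = 0) a ha b hb)
      (fun h h' ↦ hab (h.trans h'.symm)) (natAbs_ne hab)
  · rintro δ hδ a ha
    by_cases h : δ = ε
    · subst h
      obtain ⟨x, hx, hax⟩ := (by decide : ∀ a ∈ ({-3, -1, 1, 3} : Finset ℤ), ∃ x ∈ allValues,
        a - x ∈ ({-3, -1, 1, 3} : Finset ℤ)) a ha
      refine Par.intro ?_ (h₂.lower x hx)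
      rw [← mul_sub]
      exact h₁.diag δ (diag hδ) _ hax
    · obtain rfl : δ = -ε := by
        rcases Int.units_eq_one_or ε with rfl | rfl <;>
          rcases Int.units_eq_one_or δ with rfl | rfl <;> simp_all
      have : ∀ a ∈ ({-3, -1, 1, 3} : Finset ℤ), ((-ε : ℤˣ) : ℤ) * a ∈ oddValues ∧
          a ∈ oddValues ∧ (a - (-ε : ℤˣ) * a) % 2 = 0 ∧ a.natAbs ≠ 5 ∧
          ((-ε : ℤˣ) : ℤ) * a ≠ ε * a := by
        rcases Int.units_eq_one_or ε with rfl | rfl <;> decide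
      obtain ⟨h1, h2, h3, h4, h5⟩ := this a ha
      exact key a (Finset.mem_union_left _ h2) _ (Finset.mem_union_left _ h1) h3 (absurd · h4) h5
  · exact fun _ b hb ↦ key 0 (by decide) b (by simp [hb]) (by revert b; decide) (by simp)
      (natAbs_ne (by revert b; decide))
  · exact fun _ a ha ↦ key a (by simp [ha]) 0 (by decide) (by revert a; decide)
      (by revert a; decide) (natAbs_ne (by revert a; decide))
  · exact .inr fun a ha b hb hab ↦ key a (by simp [ha]) b (by simp [hb])
      ((by decide : ∀ a ∈ evenValues, ∀ b ∈ evenValues, (a - b) % 2 = 0) a ha b hb)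
      (fun h h' ↦ hab (h.trans h'.symm)) (natAbs_ne hab)

/-- Even boundary values are sums of two odd ones; odd boundary values are sums of an odd and an even
one, where either alternative in `UnbalancedPair.even` suffices. -/
lemma UnbalancedPair.par (h₁ : UnbalancedPair Q₁ R₁) (h₂ : UnbalancedPair Q₂ R₂) :
    UnbalancedPair (Par Q₁ Q₂) (Par R₁ R₂) := by
  have evens : ∀ a ∈ insert 0 evenValues, ∀ b ∈ insert 0 evenValues, Par R₁ R₂ a b := by
    have : ∀ a ∈ insert 0 evenValues, ∀ b ∈ insert 0 evenValues,
        ∃ x ∈ oddValues, ∃ y ∈ oddValues, x.natAbs ≠ y.natAbs ∧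
          a - x ∈ oddValues ∧ b - y ∈ oddValues ∧ (a - x).natAbs ≠ (b - y).natAbs := by
      decide +kernel
    intro a ha b hb
    obtain ⟨x, hx, y, hy, hxy, hx', hy', hxy'⟩ := this a ha b hb
    exact Par.intro (h₁.odd _ hx' _ hy' hxy') (h₂.odd x hx y hy hxy)
  have odds : ∀ a ∈ oddValues, ∀ b ∈ oddValues, (a.natAbs = 5 → b.natAbs ≠ 5) →
      Par R₁ R₂ a b := by
    intro a ha b hb hab
    rcases h₂.even with h | h
    · obtain ⟨x, hx, y, hy, hxy, hx', hy', hxy'⟩ :=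
        (by decide +kernel : ∀ a ∈ oddValues, ∀ b ∈ oddValues, (a.natAbs = 5 → b.natAbs ≠ 5) →
          ∃ x ∈ evenValues, ∃ y ∈ evenValues, x.natAbs = y.natAbs ∧
            a - x ∈ oddValues ∧ b - y ∈ oddValues ∧ (a - x).natAbs ≠ (b - y).natAbs) a ha b hb hab
      exact Par.intro (h₁.odd _ hx' _ hy' hxy') (h x hx y hy hxy)
    · obtain ⟨x, hx, y, hy, hxy, hx', hy', hxy'⟩ :=
        (by decide +kernel : ∀ a ∈ oddValues, ∀ b ∈ oddValues, (a.natAbs = 5 → b.natAbs ≠ 5) →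
          ∃ x ∈ evenValues, ∃ y ∈ evenValues, x.natAbs ≠ y.natAbs ∧
            a - x ∈ oddValues ∧ b - y ∈ oddValues ∧ (a - x).natAbs ≠ (b - y).natAbs) a ha b hb hab
      exact Par.intro (h₁.odd _ hx' _ hy' hxy') (h x hx y hy hxy)
  refine ⟨fun _ ↦ evens 0 (by simp) 0 (by simp), ?_, ?_, ?_, ?_, ?_⟩
  · exact fun a ha b hb hab ↦ odds a ha b hb fun h h' ↦ hab (h.trans h'.symm)
  · intro ε _ a ha
    have : ∀ a ∈ ({-3, -1, 1, 3} : Finset ℤ), a ∈ oddValues ∧ (ε : ℤ) * a ∈ oddValues ∧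
        a.natAbs ≠ 5 := by
      rcases Int.units_eq_one_or ε with rfl | rfl <;> decide
    obtain ⟨h1, h2, h3⟩ := this a ha
    exact odds a h1 _ h2 (absurd · h3)
  · exact fun _ b hb ↦ evens 0 (by simp) b (by simp [hb])
  · exact fun _ a ha ↦ evens a (by simp [ha]) 0 (by simp)
  · exact .inl fun a ha b hb _ ↦ evens a (by simp [ha]) b (by simp [hb])

/-! ### Series connection of the invariants -/

open Relation

lemma BalancedPair.comp (h₁ : BalancedPair ε Q₁ R₁) (h₂ : BalancedPair δ Q₂ R₂) :
    BalancedPair (δ * ε) (Comp Q₁ Q₂) (Comp R₁ R₂) where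
  eq_mul := by
    rintro a b ⟨m, hq₁, hq₂⟩
    rw [h₂.eq_mul _ _ hq₂, h₁.eq_mul _ _ hq₁, Units.val_mul, mul_assoc]
  zero := by
    rintro ⟨m, hq₁, hq₂⟩
    obtain rfl : m = 0 := by simpa using h₁.eq_mul _ _ hq₁
    exact ⟨0, h₁.zero hq₁, h₂.zero hq₂⟩
  lower x hx := by
    have : (ε : ℤ) * x ∈ allValues := by
      revert x
      rcases Int.units_eq_one_or ε with rfl | rfl <;> decide
    exact ⟨ε * x, h₁.lower x hx, by simpa [mul_assoc] using h₂.lower _ this⟩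

lemma UnbalancedPair.comp_balanced (h₁ : UnbalancedPair Q₁ R₁) (h₂ : BalancedPair ε Q₂ R₂) :
    UnbalancedPair (Comp Q₁ Q₂) (Comp R₁ R₂) := by
  have cancel : ∀ b : ℤ, (ε : ℤ) * (ε * b) = b := fun b ↦ by
    rw [← mul_assoc, ← Units.val_mul, Int.units_mul_self, Units.val_one, one_mul]
  have natAbs_mul : ∀ b : ℤ, ((ε : ℤ) * b).natAbs = b.natAbs := fun b ↦ by
    rw [Int.natAbs_mul, Int.units_natAbs, one_mul]
  have step : ∀ a b, b ∈ allValues → R₁ a (ε * b) → Comp R₁ R₂ a b := fun a b hb h ↦ by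
    refine ⟨ε * b, h, ?_⟩
    have : (ε : ℤ) * b ∈ allValues := by
      clear h
      revert b
      rcases Int.units_eq_one_or ε with rfl | rfl <;> decide
    simpa only [cancel] using h₂.lower _ this
  have odd_mul : ∀ b ∈ oddValues, (ε : ℤ) * b ∈ oddValues := by
    rcases Int.units_eq_one_or ε with rfl | rfl <;> decide
  have even_mul : ∀ b ∈ evenValues, (ε : ℤ) * b ∈ evenValues := by
    rcases Int.units_eq_one_or ε with rfl | rfl <;> decide
  have odd_sub : oddValues ⊆ allValues := by decide
  have even_sub : evenValues ⊆ allValues := by decide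
  -- A zero value at the second terminal forces a zero value at the middle vertex.
  have mid : ∀ a, Comp Q₁ Q₂ a 0 → Q₁ a 0 ∧ Q₂ 0 0 := by
    rintro a ⟨m, hq₁, hq₂⟩
    obtain rfl : m = 0 := by
      have := h₂.eq_mul _ _ hq₂
      simpa using this.symm
    exact ⟨hq₁, hq₂⟩
  refine ⟨fun h ↦ ⟨0, h₁.zero (mid 0 h).1, h₂.zero (mid 0 h).2⟩, ?_, ?_, ?_, ?_, ?_⟩
  · exact fun a ha b hb hab ↦ step a b (odd_sub hb)
      (h₁.odd a ha _ (odd_mul b hb) (by rwa [natAbs_mul]))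
  · rintro δ ⟨a, m, hq₁, hq₂⟩ x hx
    have hm : m = (ε * δ : ℤˣ) * a := by
      rw [Units.val_mul, mul_assoc, h₂.eq_mul _ _ hq₂, cancel]
    have : ∀ x ∈ ({-3, -1, 1, 3} : Finset ℤ), (δ : ℤ) * x ∈ allValues := by
      rcases Int.units_eq_one_or δ with rfl | rfl <;> decide
    refine step _ _ (this x hx) ?_
    rw [← mul_assoc, ← Units.val_mul]
    exact h₁.diag _ ⟨a, hm ▸ hq₁⟩ x hx
  · rintro ⟨b, m, hq₁, -⟩ x hx
    exact step _ _ (even_sub hx) (h₁.left ⟨m, hq₁⟩ _ (even_mul x hx))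
  · rintro ⟨a, h⟩ x hx
    obtain ⟨hq₁, hq₂⟩ := mid a h
    exact ⟨0, h₁.right ⟨a, hq₁⟩ x hx, h₂.zero hq₂⟩
  · refine h₁.even.imp (fun h ↦ ?_) fun h ↦ ?_ <;> intro a ha b hb hab <;>
      exact step a b (even_sub hb) (h a ha _ (even_mul b hb) (by rwa [natAbs_mul]))

lemma BalancedPair.flip (h : BalancedPair ε Q R) : BalancedPair ε (flip Q) (flip R) where
  eq_mul a b hq := by
    rw [h.eq_mul _ _ hq, ← mul_assoc, ← Units.val_mul, Int.units_mul_self, Units.val_one, one_mul]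
  zero := h.zero
  lower x hx := by
    have : (ε : ℤ) * x ∈ allValues := by
      revert x
      rcases Int.units_eq_one_or ε with rfl | rfl <;> decide
    have := h.lower _ this
    rwa [← mul_assoc, ← Units.val_mul, Int.units_mul_self, Units.val_one, one_mul] at this

lemma UnbalancedPair.flip (h : UnbalancedPair Q R) : UnbalancedPair (flip Q) (flip R) where
  zero := h.zero
  odd a ha b hb hab := h.odd b hb a ha hab.symm
  diag ε := by
    rintro ⟨a, ha⟩ x hx
    have cancel : ∀ b : ℤ, (ε : ℤ) * (ε * b) = b := fun b ↦ by
      rw [← mul_assoc, ← Units.val_mul, Int.units_mul_self, Units.val_one, one_mul]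
    have mem : (ε : ℤ) * x ∈ ({-3, -1, 1, 3} : Finset ℤ) := by
      revert x
      rcases Int.units_eq_one_or ε with rfl | rfl <;> decide
    have ha' : Q (ε * a) (ε * (ε * a)) := by rwa [cancel]
    have := h.diag ε ⟨_, ha'⟩ _ mem
    rwa [cancel] at this
  left := h.right
  right := h.left
  even := h.even.imp (fun h a ha b hb hab ↦ h b hb a ha hab.symm)
    (fun h a ha b hb hab ↦ h b hb a ha hab.symm)

/-- An odd value at the middle vertex can avoid two absolute values among 1, 3, 5. For even values,
the two alternatives in `UnbalancedPair.even` multiply like signs: on `{2, 4}`, being of the same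
absolute value and being of distinct absolute values compose like the elements of a group of order
two. -/
lemma UnbalancedPair.comp (h₁ : UnbalancedPair Q₁ R₁) (h₂ : UnbalancedPair Q₂ R₂) :
    UnbalancedPair (Comp Q₁ Q₂) (Comp R₁ R₂) := by
  have odds : ∀ a ∈ oddValues, ∀ b ∈ oddValues, Comp R₁ R₂ a b := by
    intro a ha b hb
    obtain ⟨m, hm, ham, hmb⟩ := (by decide +kernel : ∀ a ∈ oddValues, ∀ b ∈ oddValues,
      ∃ m ∈ oddValues, a.natAbs ≠ m.natAbs ∧ m.natAbs ≠ b.natAbs) a ha b hb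
    exact ⟨m, h₁.odd a ha m hm ham, h₂.odd m hm b hb hmb⟩
  have ex₁ : ∀ b ∈ evenValues, ∃ m ∈ evenValues, R₁ b m := by
    intro b hb
    rcases h₁.even with h | h
    · exact ⟨b, hb, h b hb b hb rfl⟩
    · obtain ⟨m, hm, hbm⟩ := (by decide : ∀ b ∈ evenValues,
        ∃ m ∈ evenValues, b.natAbs ≠ m.natAbs) b hb
      exact ⟨m, hm, h b hb m hm hbm⟩
  have ex₂ : ∀ b ∈ evenValues, ∃ m ∈ evenValues, R₂ m b := by
    intro b hb
    rcases h₂.even with h | h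
    · exact ⟨b, hb, h b hb b hb rfl⟩
    · obtain ⟨m, hm, hbm⟩ := (by decide : ∀ b ∈ evenValues,
        ∃ m ∈ evenValues, m.natAbs ≠ b.natAbs) b hb
      exact ⟨m, hm, h m hm b hb hbm⟩
  refine ⟨?_, fun a ha b hb _ ↦ odds a ha b hb, ?_, ?_, ?_, ?_⟩
  · rintro ⟨m, hq₁, hq₂⟩
    exact ⟨2, h₁.left ⟨m, hq₁⟩ 2 (by decide), h₂.right ⟨m, hq₂⟩ 2 (by decide)⟩
  · intro ε _ a ha
    have : ∀ a ∈ ({-3, -1, 1, 3} : Finset ℤ), a ∈ oddValues ∧ (ε : ℤ) * a ∈ oddValues := by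
      rcases Int.units_eq_one_or ε with rfl | rfl <;> decide
    exact odds a (this a ha).1 _ (this a ha).2
  · rintro ⟨b, m, hq₁, -⟩ x hx
    obtain ⟨n, hn, hnx⟩ := ex₂ x hx
    exact ⟨n, h₁.left ⟨m, hq₁⟩ n hn, hnx⟩
  · rintro ⟨a, m, -, hq₂⟩ x hx
    obtain ⟨n, hn, hnx⟩ := ex₁ x hx
    exact ⟨n, hnx, h₂.right ⟨m, hq₂⟩ n hn⟩
  · have other : ∀ a ∈ evenValues, ∃ m ∈ evenValues, a.natAbs ≠ m.natAbs := by decide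
    have trans : ∀ a ∈ evenValues, ∀ m ∈ evenValues, ∀ b ∈ evenValues,
        a.natAbs ≠ m.natAbs → a.natAbs = b.natAbs → m.natAbs ≠ b.natAbs := by decide +kernel
    rcases h₁.even with h | h <;> rcases h₂.even with h' | h'
    · exact .inl fun a ha b hb hab ↦ ⟨a, h a ha a ha rfl, h' a ha b hb hab⟩
    · exact .inr fun a ha b hb hab ↦ ⟨a, h a ha a ha rfl, h' a ha b hb hab⟩
    · exact .inr fun a ha b hb hab ↦ ⟨b, h a ha b hb hab, h' b hb b hb rfl⟩
    · refine .inl fun a ha b hb hab ↦ ?_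
      obtain ⟨m, hm, ham⟩ := other a ha
      exact ⟨m, h a ha m hm ham, h' m hm b hb (trans a ha m hm b hb ham hab)⟩

universe u v

/-! ### Half-edge functions and their boundary values -/

variable {α : Type u} {β : Type v} {G H K : Graph α β} {S : Set α} {s t m x : α}
  {σ : β → ℤˣ} {P : Set ℤ}

/-- The sum of the values of a half-edge function `f` at the vertex `x`. It is meaningful for graphs
without loops that have finitely many edges. -/
noncomputable def net (G : Graph α β) (f : β → α → ℤ) (x : α) : ℤ :=
  ∑ᶠ e ∈ {e | G.Inc e x}, f e x

/-- A half-edge function whose values lie in `P` and that is compatible with the signs: its values on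
the two halves of an edge are opposite for a positive edge and equal for a negative edge. This
encodes an orientation together with an edge valuation, up to reversing an edge and negating its
value; conservation is not part of the definition. -/
def IsHalfEdgeFlow (G : Graph α β) (σ : β → ℤˣ) (P : Set ℤ) (f : β → α → ℤ) : Prop :=
  ∀ e x y, G.IsLink e x y → f e x ∈ P ∧ f e y = -(σ e * f e x)

/-- `(a, b)` is a boundary value of `(G, s, t)`: some half-edge function with values in `P` is
conservative except at the terminals, its net inflow being `a` at `s` and `-b` at `t`. With this
choice of signs, a positive edge from `s` to `t` has the boundary values `(x, x)`, and series
connection becomes composition of relations. -/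
def Transmits (G : Graph α β) (σ : β → ℤˣ) (P : Set ℤ) (s t : α) (a b : ℤ) : Prop :=
  ∃ f, IsHalfEdgeFlow G σ P f ∧ (∀ x, x ≠ s → x ≠ t → net G f x = 0) ∧
    net G f s = a ∧ net G f t = -b

lemma net_eq_zero (hx : x ∉ V(G)) (f : β → α → ℤ) : net G f x = 0 := by
  have : {e | G.Inc e x} = ∅ := Set.eq_empty_of_forall_notMem fun e he ↦ hx he.vertex_mem
  simp [net, this]

lemma net_congr {f g : β → α → ℤ} (h : ∀ e ∈ E(G), f e = g e) (x : α) :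
    net G f x = net G g x :=
  finsum_mem_congr rfl fun e he ↦ by rw [h e (Graph.Inc.edge_mem he)]

lemma IsHalfEdgeFlow.mono (hHG : H ≤ G) {f : β → α → ℤ} (h : IsHalfEdgeFlow G σ P f) :
    IsHalfEdgeFlow H σ P f :=
  fun e x y hl ↦ h e x y (hl.mono hHG)

lemma IsHalfEdgeFlow.congr {f g : β → α → ℤ} (h : ∀ e ∈ E(G), f e = g e)
    (hf : IsHalfEdgeFlow G σ P f) : IsHalfEdgeFlow G σ P g :=
  fun e x y hl ↦ h e hl.edge_mem ▸ hf e x y hl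

namespace IsGluing

lemma isLink_or (hG : IsGluing G H K S) {e : β} {x y : α} (h : G.IsLink e x y) :
    H.IsLink e x y ∨ K.IsLink e x y := by
  have := h.edge_mem
  rw [hG.edgeSet_eq] at this
  exact this.imp (fun he ↦ (Graph.IsSubgraph.isLink_iff hG.left_le he).2 h)
    fun he ↦ (Graph.IsSubgraph.isLink_iff hG.right_le he).2 h

lemma finite (hG : IsGluing G H K S) (hH : E(H).Finite) (hK : E(K).Finite) : E(G).Finite :=
  hG.edgeSet_eq ▸ hH.union hK

lemma net_eq (hG : IsGluing G H K S) (hfin : E(G).Finite) (f : β → α → ℤ) (x : α) :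
    net G f x = net H f x + net K f x := by
  have hset : {e | G.Inc e x} = {e | H.Inc e x} ∪ {e | K.Inc e x} := by
    ext e
    constructor
    · rintro ⟨y, hy⟩
      exact (hG.isLink_or hy).imp (fun h ↦ ⟨y, h⟩) fun h ↦ ⟨y, h⟩
    · rintro (⟨y, hy⟩ | ⟨y, hy⟩)
      · exact ⟨y, hy.mono hG.left_le⟩
      · exact ⟨y, hy.mono hG.right_le⟩
  have hsub : {e | G.Inc e x} ⊆ E(G) := fun e he ↦ Graph.Inc.edge_mem he
  have hfin' := hfin.subset hsub
  rw [hset] at hfin'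
  rw [net, hset, finsum_mem_union _ (hfin'.subset Set.subset_union_left)
    (hfin'.subset Set.subset_union_right)]
  · rfl
  · exact hG.edge_disjoint.mono (fun e he ↦ Graph.Inc.edge_mem he)
      fun e he ↦ Graph.Inc.edge_mem he

/-- Half-edge flows on the two parts of a gluing have a common extension. -/
lemma exists_glue (hG : IsGluing G H K S) (hfin : E(G).Finite) {f g : β → α → ℤ}
    (hf : IsHalfEdgeFlow H σ P f) (hg : IsHalfEdgeFlow K σ P g) :
    ∃ h, IsHalfEdgeFlow G σ P h ∧ ∀ x, net G h x = net H f x + net K g x := by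
  classical
  let h : β → α → ℤ := fun e ↦ if e ∈ E(H) then f e else g e
  have hhf : ∀ e ∈ E(H), f e = h e := fun e he ↦ (if_pos he).symm
  have hhg : ∀ e ∈ E(K), g e = h e := fun e he ↦
    (if_neg (Set.disjoint_right.1 hG.edge_disjoint he)).symm
  refine ⟨h, fun e x y hl ↦ ?_, fun x ↦ ?_⟩
  · rcases hG.isLink_or hl with hl | hl
    · exact hf.congr hhf e x y hl
    · exact hg.congr hhg e x y hl
  · rw [hG.net_eq hfin, net_congr hhf, net_congr hhg]

lemma notMem_left (hG : IsGluing G H K S) (hx : x ∉ S) (hK : x ∈ V(K)) : x ∉ V(H) :=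
  fun h ↦ hx (hG.vertex_inter ▸ ⟨h, hK⟩)

lemma notMem_right (hG : IsGluing G H K S) (hx : x ∉ S) (hH : x ∈ V(H)) : x ∉ V(K) :=
  fun h ↦ hx (hG.vertex_inter ▸ ⟨hH, h⟩)

lemma net_left_eq_zero_or (hG : IsGluing G H K S) (hx : x ∉ S) (f g : β → α → ℤ) :
    net H f x = 0 ∨ net K g x = 0 := by
  by_cases h : x ∈ V(H)
  · exact .inr (net_eq_zero (hG.notMem_right hx h) g)
  · exact .inl (net_eq_zero h f)

end IsGluing

/-! ### Boundary values of series and parallel connections -/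

lemma transmits_parallel (hG : IsGluing G H K {s, t}) (hfin : E(G).Finite) :
    Transmits G σ P s t = Par (Transmits H σ P s t) (Transmits K σ P s t) := by
  ext a b
  constructor
  · rintro ⟨f, hf, hz, rfl, hb⟩
    have hz' : ∀ x, x ≠ s → x ≠ t → net H f x = 0 ∧ net K f x = 0 := by
      intro x hs ht
      have h₁ := hz x hs ht
      rw [hG.net_eq hfin] at h₁
      have := hG.net_left_eq_zero_or (x := x) (by simp [hs, ht]) f f
      omega
    refine ⟨_, _, _, _, ⟨f, hf.mono hG.left_le, fun x hs ht ↦ (hz' x hs ht).1, rfl,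
      (neg_neg _).symm⟩, ⟨f, hf.mono hG.right_le, fun x hs ht ↦ (hz' x hs ht).2, rfl,
      (neg_neg _).symm⟩, hG.net_eq hfin f s, ?_⟩
    have := hG.net_eq hfin f t
    omega
  · rintro ⟨_, _, _, _, ⟨f, hf, hfz, rfl, hfb⟩, ⟨g, hg, hgz, rfl, hgb⟩, rfl, rfl⟩
    obtain ⟨h, hh, hnet⟩ := hG.exists_glue hfin hf hg
    refine ⟨h, hh, fun x hs ht ↦ ?_, hnet s, ?_⟩
    · rw [hnet, hfz x hs ht, hgz x hs ht, add_zero]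
    · rw [hnet, hfb, hgb, neg_add]

lemma transmits_series (hG : IsGluing G H K {m}) (hfin : E(G).Finite) (hsm : s ≠ m) (hmt : m ≠ t)
    (hs : s ∈ V(H)) (ht : t ∈ V(K)) :
    Transmits G σ P s t = Comp (Transmits H σ P s m) (Transmits K σ P m t) := by
  have hsK : s ∉ V(K) := hG.notMem_right (by simpa using hsm) hs
  have htH : t ∉ V(H) := hG.notMem_left (by simpa using hmt.symm) ht
  ext a b
  constructor
  · rintro ⟨f, hf, hz, rfl, hb⟩
    refine ⟨net K f m, ⟨f, hf.mono hG.left_le, fun x hs hm ↦ ?_, ?_, ?_⟩,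
      ⟨f, hf.mono hG.right_le, fun x hm ht ↦ ?_, rfl, ?_⟩⟩
    · by_cases hxt : x = t
      · rw [hxt, net_eq_zero htH]
      have h₁ := hz x hs hxt
      rw [hG.net_eq hfin] at h₁
      have := hG.net_left_eq_zero_or (x := x) (by simpa using hm) f f
      omega
    · rw [hG.net_eq hfin, net_eq_zero hsK, add_zero]
    · have h₁ := hz m hsm.symm hmt
      rw [hG.net_eq hfin] at h₁
      omega
    · by_cases hxs : x = s
      · rw [hxs, net_eq_zero hsK]
      have h₁ := hz x hxs ht
      rw [hG.net_eq hfin] at h₁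
      have := hG.net_left_eq_zero_or (x := x) (by simpa using hm) f f
      omega
    · rw [← hb, hG.net_eq hfin, net_eq_zero htH, zero_add]
  · rintro ⟨c, ⟨f, hf, hfz, rfl, hfb⟩, ⟨g, hg, hgz, hga, hgb⟩⟩
    obtain ⟨h, hh, hnet⟩ := hG.exists_glue hfin hf hg
    refine ⟨h, hh, fun x hs ht ↦ ?_, ?_, ?_⟩
    · by_cases hxm : x = m
      · rw [hxm, hnet, hfb, hga, neg_add_cancel]
      · rw [hnet, hfz x hs hxm, hgz x hxm ht, add_zero]
    · rw [hnet, net_eq_zero hsK, add_zero]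
    · rw [hnet, net_eq_zero htH, zero_add, hgb]

lemma net_banana (s t : α) (e : β) (f : β → α → ℤ) :
    net (Graph.banana s t {e}) f s = f e s ∧ net (Graph.banana s t {e}) f t = f e t := by
  simp [net]

lemma balancedPair_edge (e : β) (hst : s ≠ t) :
    BalancedPair (σ e) (Transmits (Graph.banana s t {e}) σ {v | v ≠ 0} s t)
      (Transmits (Graph.banana s t {e}) σ {v | v ≠ 0 ∧ |v| < 6} s t) := by
  classical
  have hl : (Graph.banana s t {e}).IsLink e s t := by simp
  have upper : ∀ a b, Transmits (Graph.banana s t {e}) σ {v | v ≠ 0} s t a b →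
      a ≠ 0 ∧ b = σ e * a := by
    rintro a b ⟨f, hf, -, rfl, hb⟩
    rw [(net_banana s t e f).2] at hb
    rw [(net_banana s t e f).1]
    obtain ⟨h₀, h₁⟩ := hf e s t hl
    exact ⟨h₀, by omega⟩
  refine ⟨fun a b h ↦ (upper a b h).2, fun h ↦ absurd rfl (upper 0 0 h).1, fun x hx ↦ ?_⟩
  refine ⟨fun _ y ↦ if y = s then x else -(σ e * x), ?_, ?_, ?_, ?_⟩
  · have : ∀ x ∈ allValues, x ≠ 0 ∧ |x| < 6 := by decide
    have hx' := this x hx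
    have hsq : (σ e : ℤ) * (σ e * x) = x := by
      rw [← mul_assoc, ← Units.val_mul, Int.units_mul_self, Units.val_one, one_mul]
    have hσ : |((σ e : ℤˣ) : ℤ)| = 1 := Int.isUnit_iff_abs_eq.1 (σ e).isUnit
    intro e' y z hyz
    obtain ⟨rfl, ⟨rfl, rfl⟩ | ⟨rfl, rfl⟩⟩ : e' = e ∧ (y = s ∧ z = t ∨ y = t ∧ z = s) := by
      simpa using hyz
    · simpa [hst.symm] using hx'
    · simp [hst.symm, hsq, abs_mul, hσ, hx']
  · intro y hs ht
    exact net_eq_zero (by simp [hs, ht]) _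
  · simp [(net_banana s t e _).1]
  · simp [(net_banana s t e _).2, hst.symm]

/-! ### The invariant for series-parallel graphs -/

namespace IsSeriesParallel

lemma ne_and_mem (h : IsSeriesParallel G s t) : s ≠ t ∧ s ∈ V(G) ∧ t ∈ V(G) := by
  induction h with
  | edge e s t hst => simp [hst]
  | series G H K s m t hH hK hG ihH ihK =>
    refine ⟨?_, hG.vertexSet_eq ▸ .inl ihH.2.1, hG.vertexSet_eq ▸ .inr ihK.2.2⟩
    rintro rfl
    exact hG.notMem_right (by simpa using ihH.1) ihH.2.1 ihK.2.2
  | parallel G H K s t hH hK hG ihH ihK =>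
    exact ⟨ihH.1, hG.vertexSet_eq ▸ .inl ihH.2.1, hG.vertexSet_eq ▸ .inl ihH.2.2⟩

lemma finite_edgeSet (h : IsSeriesParallel G s t) : E(G).Finite := by
  induction h with
  | edge e s t hst => simp
  | series G H K s m t hH hK hG ihH ihK => exact hG.finite ihH ihK
  | parallel G H K s t hH hK hG ihH ihK => exact hG.finite ihH ihK

/-- By induction on the construction of the graph, one of the two invariants holds. -/
theorem balanced_or_unbalanced (h : IsSeriesParallel G s t) (σ : β → ℤˣ) :
    (∃ ε, BalancedPair ε (Transmits G σ {v | v ≠ 0} s t)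
        (Transmits G σ {v | v ≠ 0 ∧ |v| < 6} s t)) ∨
      UnbalancedPair (Transmits G σ {v | v ≠ 0} s t)
        (Transmits G σ {v | v ≠ 0 ∧ |v| < 6} s t) := by
  induction h with
  | edge e s t hst => exact .inl ⟨σ e, balancedPair_edge e hst⟩
  | series G H K s m t hH hK hG ihH ihK =>
    have hfin := hG.finite hH.finite_edgeSet hK.finite_edgeSet
    have hsm := hH.ne_and_mem
    have hmt := hK.ne_and_mem
    rw [transmits_series hG hfin hsm.1 hmt.1 hsm.2.1 hmt.2.2,
      transmits_series hG hfin hsm.1 hmt.1 hsm.2.1 hmt.2.2]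
    rcases ihH with ⟨ε, hH⟩ | hH <;> rcases ihK with ⟨δ, hK⟩ | hK
    · exact .inl ⟨_, hH.comp hK⟩
    -- Reversing the graph exchanges the roles of its parts and its terminals.
    · have := (hK.flip.comp_balanced hH.flip).flip
      rw [← flip_comp, ← flip_comp] at this
      exact .inr this
    · exact .inr (hH.comp_balanced hK)
    · exact .inr (hH.comp hK)
  | parallel G H K s t hH hK hG ihH ihK =>
    have hfin := hG.finite hH.finite_edgeSet hK.finite_edgeSet
    rw [transmits_parallel hG hfin, transmits_parallel hG hfin]
    rcases ihH with ⟨ε, hH⟩ | hH <;> rcases ihK with ⟨δ, hK⟩ | hK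
    · rcases Int.units_eq_one_or ε with rfl | rfl <;> rcases Int.units_eq_one_or δ with rfl | rfl
      · exact .inl ⟨1, hH.par_same hK⟩
      · exact .inr (hH.par_opposite hK)
      · rw [Par.comm, Par.comm (Transmits H σ _ s t)]
        exact .inr (hK.par_opposite hH)
      · exact .inl ⟨-1, hH.par_same hK⟩
    · rw [Par.comm, Par.comm (Transmits H σ _ s t)]
      exact .inr (hK.par_balanced hH)
    · exact .inr (hH.par_balanced hK)
    · exact .inr (hH.par hK)

end IsSeriesParallel

/-! ### Nowhere-zero flows as half-edge functions -/

lemma IsNowhereZeroFlow.transmits_zero {D : β → α → Prop} {φ : β → ℤ} {k : ℕ}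
    (h : IsNowhereZeroFlow G σ k D φ) (hfin : E(G).Finite) (s t : α) :
    Transmits G σ {v | v ≠ 0} s t 0 0 := by
  classical
  let f : β → α → ℤ := fun e x ↦ if D e x then φ e else -φ e
  have hnet : ∀ x, net G f x = 0 := by
    intro x
    by_cases hx : x ∈ V(G)
    swap
    · exact net_eq_zero hx f
    have hset : {e | G.Inc e x} = {e | G.Inc e x ∧ D e x} ∪ {e | G.Inc e x ∧ ¬ D e x} := by
      ext e
      simp only [Set.mem_union, Set.mem_ofPred_eq]
      tauto
    have hin : ∑ᶠ e ∈ {e | G.Inc e x ∧ D e x}, f e x = inflow G D φ x :=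
      finsum_mem_congr rfl fun e he ↦ if_pos he.2
    have hout : ∑ᶠ e ∈ {e | G.Inc e x ∧ ¬ D e x}, f e x = -outflow G D φ x := by
      rw [outflow, ← finsum_mem_neg_distrib _ (hfin.subset fun e he ↦ he.1.edge_mem)]
      exact finsum_mem_congr rfl fun e he ↦ if_neg he.2
    rw [net, hset, finsum_mem_union, hin, hout, h.conservation x hx, add_neg_cancel]
    · exact Set.disjoint_left.2 fun e he he' ↦ he'.2 he.2
    · exact hfin.subset fun e he ↦ he.1.edge_mem
    · exact hfin.subset fun e he ↦ he.1.edge_mem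
  refine ⟨f, fun e x y hl ↦ ?_, fun x _ _ ↦ hnet x, hnet s, by simpa using hnet t⟩
  have hne := h.ne_zero e hl.edge_mem
  have ho := h.orientation e x y hl
  constructor
  · by_cases hx : D e x <;> simpa [f, hx] using hne
  · rcases Int.units_eq_one_or (σ e) with hσ | hσ
    · have := ho.1 hσ
      by_cases hx : D e x <;> by_cases hy : D e y <;> simp_all [f, Xor]
    · have := ho.2 hσ
      by_cases hx : D e x <;> by_cases hy : D e y <;> simp_all [f]

/-- A half-edge function is turned into a flow by letting the half-edges with a positive value point
to their ends, and assigning to an edge the common absolute value of its two halves. -/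
lemma Transmits.hasNowhereZeroFlow {k : ℕ}
    (h : Transmits G σ {v | v ≠ 0 ∧ |v| < k} s t 0 0) (hfin : E(G).Finite) :
    HasNowhereZeroFlow G σ k := by
  classical
  obtain ⟨f, hf, hz, hs, ht⟩ := h
  have hnet : ∀ x, net G f x = 0 := fun x ↦ by
    by_cases hxs : x = s
    · rw [hxs, hs]
    · by_cases hxt : x = t
      · rw [hxt, ht, neg_zero]
      · exact hz x hxs hxt
  have habs : ∀ e x y, G.IsLink e x y → |f e y| = |f e x| := fun e x y hl ↦ by
    rw [(hf e x y hl).2, abs_neg, abs_mul, Int.isUnit_iff_abs_eq.1 (σ e).isUnit, one_mul]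
  -- The value 0 is irrelevant: it is assigned to elements of `β` that are not edges.
  let φ : β → ℤ := fun e ↦ if h : ∃ x, G.Inc e x then |f e h.choose| else 0
  have hφ : ∀ e x, G.Inc e x → φ e = |f e x| := by
    intro e x hx
    have hex : ∃ x, G.Inc e x := ⟨x, hx⟩
    obtain ⟨y, hy⟩ := hx
    have : φ e = |f e hex.choose| := dif_pos hex
    rw [this]
    rcases hex.choose_spec.eq_or_eq_of_isLink hy with h | h
    · rw [h]
    · rw [h, habs e x y hy]
  refine ⟨fun e x ↦ 0 < f e x, φ, fun e x y hl ↦ ?_, fun e he ↦ ?_, fun e he ↦ ?_, fun x _ ↦ ?_⟩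
  · obtain ⟨⟨h₀, -⟩, h₁⟩ := hf e x y hl
    constructor <;> intro hσ <;> rw [hσ] at h₁ <;> simp only [Units.val_neg, Units.val_one] at h₁
    · rw [xor_def]; omega
    · omega
  · obtain ⟨x, y, hl⟩ := G.exists_isLink_of_mem_edgeSet he
    rw [hφ e x hl.inc_left]
    exact abs_ne_zero.2 (hf e x y hl).1.1
  · obtain ⟨x, y, hl⟩ := G.exists_isLink_of_mem_edgeSet he
    rw [hφ e x hl.inc_left, abs_abs]
    exact (hf e x y hl).1.2
  · have hset : {e | G.Inc e x} = {e | G.Inc e x ∧ 0 < f e x} ∪ {e | G.Inc e x ∧ ¬ 0 < f e x} := by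
      ext e
      simp only [Set.mem_union, Set.mem_ofPred_eq]
      tauto
    have hin : ∑ᶠ e ∈ {e | G.Inc e x ∧ 0 < f e x}, f e x =
        inflow G (fun e x ↦ 0 < f e x) φ x :=
      finsum_mem_congr rfl fun e he ↦ by rw [hφ e x he.1, abs_of_pos he.2]
    have hout : ∑ᶠ e ∈ {e | G.Inc e x ∧ ¬ 0 < f e x}, f e x =
        -outflow G (fun e x ↦ 0 < f e x) φ x := by
      rw [outflow, ← finsum_mem_neg_distrib _ (hfin.subset fun e he ↦ he.1.edge_mem)]
      exact finsum_mem_congr rfl fun e he ↦ by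
        rw [hφ e x he.1, abs_of_nonpos (not_lt.1 he.2), neg_neg]
    have := hnet x
    rw [net, hset, finsum_mem_union, hin, hout] at this
    · omega
    · exact Set.disjoint_left.2 fun e he he' ↦ he'.2 he.2
    · exact hfin.subset fun e he ↦ he.1.edge_mem
    · exact hfin.subset fun e he ↦ he.1.edge_mem

end SignedSP

theorem theorem1 {α : Type*} {β : Type*} (G : Graph α β) (s t : α) (σ : β → ℤˣ)
    (hG : SignedSP.IsSeriesParallel G s t) (hadm : SignedSP.IsFlowAdmissible G σ) :
    SignedSP.HasNowhereZeroFlow G σ 6 := by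
  obtain ⟨k, D, φ, hφ⟩ := hadm
  have hQ := hφ.transmits_zero hG.finite_edgeSet s t
  have hR : SignedSP.Transmits G σ {v | v ≠ 0 ∧ |v| < 6} s t 0 0 := by
    rcases hG.balanced_or_unbalanced σ with ⟨ε, h⟩ | h
    · exact h.zero hQ
    · exact h.zero hQ
  exact SignedSP.Transmits.hasNowhereZeroFlow (by exact_mod_cast hR) hG.finite_edgeSet
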